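/- For $c>0$ let $H_c=-\chi_{[-c,0)}+\chi_{[0,c)}$ on $\mathbb R$, and for $a>0$ let $\mathcal G(H_c;a)=\{e^{-2\pi i m x}H_c(x-na): m,n\in\mathbb Z\}$. It is called a Gabor frame if it is a frame for $L^2(\mathbb R)$, i.e. if there are constants $A,B>0$ such that $$A\|f\|_2^2\le\sum_{m,n\in\mathbb Z}\bigl|\langle f,e^{-2\pi i m\cdot}H_c(\cdot-na)\rangle\bigr|^2\le B\|f\|_2^2\quad\text{for all } f\in L^2(\mathbb R).$$ Let $a,c$ be positive real numbers. Then the following statements hold, where $\mathbb N=\{1,2,3,\dots\}$. (i) If $c\in\mathbb N$, then $\mathcal G(H_c;a)$ is not a Gabor frame. (ii) If $a=1$ and $c\ge\frac12$, then $\mathcal G(H_c;a)$ is a Gabor frame if and only if $c=\frac{2n-1}{2}$ for some $n\in\mathbb N$. (iii) If $a<1$, $a\notin\mathbb Q$ and $\frac a2\le c<1$, then $\mathcal G(H_c;a)$ is a Gabor frame. (iv) If $a<1$, $a=\frac pq$ with coprime $p,q\in\mathbb N$ and $\frac a2\le c<1$, then $\mathcal G(H_c;a)$ is a Gabor frame if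 and only if $c\le 1-\frac1{2q}$. -/

import Mathlib

open MeasureTheory

/-- A family `v` of vectors of an inner product space is a *frame* if there are constants
`A, B > 0` with `A ‖f‖² ≤ ∑ i, |⟨f, v i⟩|² ≤ B ‖f‖²` for all `f` (the series being convergent).
The inner product of Mathlib is conjugate-linear in its first argument. -/
def IsHilbertFrame {ι E : Type*} [NormedAddCommGroup E] [InnerProductSpace ℂ E]
    (v : ι → E) : Prop :=
  ∃ A B : ℝ, 0 < A ∧ 0 < B ∧ ∀ f : E,
    Summable (fun i => ‖inner ℂ (v i) f‖ ^ 2) ∧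
    A * ‖f‖ ^ 2 ≤ ∑' i, ‖inner ℂ (v i) f‖ ^ 2 ∧
    ∑' i, ‖inner ℂ (v i) f‖ ^ 2 ≤ B * ‖f‖ ^ 2

/-- The function `x ↦ e^{-2πi m β x} g(x - n α)`. -/
noncomputable def gaborFun (g : ℝ → ℂ) (α β : ℝ) (m n : ℤ) (x : ℝ) : ℂ :=
  Complex.exp (((-2 * Real.pi * m * β * x : ℝ) : ℂ) * Complex.I) * g (x - n * α)

theorem memLp_gaborFun {g : ℝ → ℂ} (hg : MemLp g 2 volume) (α β : ℝ) (m n : ℤ) :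
    MemLp (gaborFun g α β m n) 2 volume := by
  have h1 : MemLp (fun x : ℝ => g (x - n * α)) 2 volume :=
    hg.comp_measurePreserving (measurePreserving_sub_right volume ((n : ℝ) * α))
  refine h1.of_le ?_ ?_
  · have h2 : Continuous fun x : ℝ =>
        Complex.exp (((-2 * Real.pi * m * β * x : ℝ) : ℂ) * Complex.I) := by fun_prop
    exact h2.aestronglyMeasurable.mul h1.1
  · refine Filter.Eventually.of_forall fun x => ?_
    simp only [gaborFun, norm_mul, Complex.norm_exp_ofReal_mul_I, one_mul, le_refl]

/-- The Gabor system `𝒢(g; α, β)`, as a family in `L²(ℝ)` indexed by `(m, n) ∈ ℤ × ℤ`. -/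
noncomputable def gaborSystem (g : ℝ → ℂ) (hg : MemLp g 2 volume) (α β : ℝ) (k : ℤ × ℤ) :
    Lp ℂ 2 (volume : Measure ℝ) :=
  (memLp_gaborFun hg α β k.1 k.2).toLp (gaborFun g α β k.1 k.2)

/-- The Haar function `H_c = -χ_{[-c,0)} + χ_{[0,c)}`. -/
noncomputable def haarWindow (c : ℝ) (x : ℝ) : ℂ :=
  -(Set.Ico (-c) 0).indicator (fun _ => (1 : ℂ)) x + (Set.Ico 0 c).indicator (fun _ => (1 : ℂ)) x

theorem memLp_haarWindow (c : ℝ) : MemLp (haarWindow c) 2 volume := by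
  have h1 : MemLp ((Set.Ico (-c) 0).indicator (fun _ => (1 : ℂ))) 2 (volume : Measure ℝ) :=
    memLp_indicator_const 2 measurableSet_Ico 1 (Or.inr (by simp))
  have h2 : MemLp ((Set.Ico 0 c).indicator (fun _ => (1 : ℂ))) 2 (volume : Measure ℝ) :=
    memLp_indicator_const 2 measurableSet_Ico 1 (Or.inr (by simp))
  exact h1.neg.add h2

/-- `𝒢(H_c; a) = 𝒢(H_c; a, 1)` is a Gabor frame, that is, a frame for `L²(ℝ)`. -/
def IsHaarGaborFrame (c a : ℝ) : Prop :=
  IsHilbertFrame (gaborSystem (haarWindow c) (memLp_haarWindow c) a 1)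

/-! Summing over the modulations `m` by Parseval on `(0, 1]` turns the frame sum of `f` into the
integral over `x` of `∑ₙ |∑ₖ f(x+k) H_c(x+k-na)|²` (`tsum_enorm_inner_gaborSystem`), while `‖f‖²` is
the integral of `∑ₖ |f(x+k)|²`. The question becomes whether the matrices `(H_c(x+k-na))_{n,k}` are
bounded below on `ℓ²`, uniformly in `x`; the upper bound is automatic, since rows and columns have
boundedly many entries, all of modulus at most 1.

Failure: if every row sums to zero for all `x` in an interval, long truncated constant vectors
violate the lower bound (`not_isHaarGaborFrame_of_sum_eq_zero`). A row sums to zero when a coset of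
`ℤ` meets both halves of the window in the same number `N` of points, which is a condition on `|c -
N|` and a fractional part (`sum_haarWindow_eq_zero`).

Success for `a = 1` and half-integral `c`: the matrix is a convolution whose kernel, after
centering, is `±δ` plus an odd part, and the odd part is invisible to `Re ⟨v, r⟩`
(`tsum_enorm_sq_le_of_odd_kernel`).

Success for `c < 1`: suitable rows read off a single `±v k` or a difference `v (k+1) - v k`. If from
every `k` an index of the first kind is reached in at most `L` steps, telescoping recovers `v k`
from nearby rows (`isHaarGaborFrame_of_chain`). For `c ≤ 1/2` no step is needed; for `c > 1/2` the
bound `L` comes from Diophantine approximation: density of `ℤa + ℤ` for irrational `a`, Bézout for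
`a = p/q`, the latter requiring `1 - c ≥ 1/(2q)`. -/

open Set in
theorem lintegral_eq_tsum_setLIntegral_Ioc_add_int (F : ℝ → ENNReal) :
    ∫⁻ x, F x = ∑' k : ℤ, ∫⁻ x in Ioc (0 : ℝ) 1, F (x + k) := by
  have h := lintegral_iUnion (μ := volume) (fun k : ℤ => measurableSet_Ioc)
    (pairwise_disjoint_Ioc_add_intCast (0 : ℝ)) F
  rw [iUnion_Ioc_add_intCast, Measure.restrict_univ] at h
  rw [h]
  refine tsum_congr fun k => ?_
  have h2 := (measurePreserving_add_right volume (k : ℝ)).setLIntegral_comp_preimage_emb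
    (measurableEmbedding_addRight _) F (Ioc ((0 : ℝ) + k) (0 + k + 1))
  rw [← h2]
  congr 2
  ext x
  simp only [mem_preimage, mem_Ioc]
  constructor <;> rintro ⟨h1, h2⟩ <;> constructor <;> linarith

/-! ### Values of the Haar window -/

theorem haarWindow_eq_one {c x : ℝ} (h0 : 0 ≤ x) (h1 : x < c) : haarWindow c x = 1 := by
  simp [haarWindow, Set.indicator, h0, h1, not_lt.2 h0]

theorem haarWindow_eq_neg_one {c x : ℝ} (h0 : -c ≤ x) (h1 : x < 0) : haarWindow c x = -1 := by
  simp [haarWindow, Set.indicator, h0, h1, not_le.2 h1]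

theorem haarWindow_eq_zero_of_le {c x : ℝ} (h : c ≤ x) (h0 : 0 ≤ x) : haarWindow c x = 0 := by
  simp [haarWindow, Set.indicator, not_lt.2 h, not_lt.2 h0]

theorem haarWindow_eq_zero_of_lt {c x : ℝ} (h : x < -c) (h0 : x < 0) : haarWindow c x = 0 := by
  simp [haarWindow, Set.indicator, not_le.2 h, not_le.2 h0]

theorem haarWindow_cases (c x : ℝ) :
    haarWindow c x = 1 ∨ haarWindow c x = -1 ∨ haarWindow c x = 0 := by
  rcases lt_or_ge x 0 with h | h
  · rcases lt_or_ge x (-c) with h' | h'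
    · exact Or.inr (Or.inr (haarWindow_eq_zero_of_lt h' h))
    · exact Or.inr (Or.inl (haarWindow_eq_neg_one h' h))
  · rcases lt_or_ge x c with h' | h'
    · exact Or.inl (haarWindow_eq_one h h')
    · exact Or.inr (Or.inr (haarWindow_eq_zero_of_le h' h))

theorem norm_haarWindow_le (c x : ℝ) : ‖haarWindow c x‖ ≤ 1 := by
  rcases haarWindow_cases c x with h | h | h <;> simp [h]

theorem conj_haarWindow (c x : ℝ) : (starRingEnd ℂ) (haarWindow c x) = haarWindow c x := by
  rcases haarWindow_cases c x with h | h | h <;> simp [h]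

theorem measurable_haarWindow (c : ℝ) : Measurable (haarWindow c) := by
  unfold haarWindow
  exact ((measurable_const.indicator measurableSet_Ico).neg).add
    (measurable_const.indicator measurableSet_Ico)

/-! ### Reduction to fiber matrices -/

/-- The indices `k` for which `H_c (x + k - n a)` may be nonzero for some `x ∈ [0, 1]`, when
`c + 2 ≤ M`. -/
noncomputable def rowSupport (a : ℝ) (M n : ℤ) : Finset ℤ :=
  Finset.Icc (⌊n * a⌋ - M) (⌊n * a⌋ + M)

theorem haarWindow_eq_zero_of_notMem_rowSupport {a c x : ℝ} {M n k : ℤ} (hc : 0 < c)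
    (hM : c + 2 ≤ M) (hx : x ∈ Set.Icc (0 : ℝ) 1) (hk : k ∉ rowSupport a M n) :
    haarWindow c (x + k - n * a) = 0 := by
  rw [rowSupport, Finset.mem_Icc, not_and_or, not_le, not_le] at hk
  have h1 := Int.floor_le (n * a)
  have h2 := Int.lt_floor_add_one (n * a)
  obtain ⟨hx0, hx1⟩ := hx
  rcases hk with hk | hk
  · have hk' : (k : ℝ) + 1 ≤ ⌊n * a⌋ - M := by exact_mod_cast hk
    exact haarWindow_eq_zero_of_lt (by linarith) (by linarith)
  · have hk' : (⌊n * a⌋ : ℝ) + M + 1 ≤ k := by exact_mod_cast hk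
    exact haarWindow_eq_zero_of_le (by linarith) (by linarith)

/-- The `n`-th row of the fiber matrix `(H_c (x + k - n a))_{n, k}` applied to the vector `v`. -/
noncomputable def gaborRow (c a : ℝ) (M : ℤ) (v : ℤ → ℂ) (x : ℝ) (n : ℤ) : ℂ :=
  ∑ k ∈ rowSupport a M n, v k * haarWindow c (x + k - n * a)

theorem MeasureTheory.MemLp.comp_add_int {f : ℝ → ℂ} (hf : MemLp f 2 volume) (k : ℤ) :
    MemLp (fun x : ℝ => f (x + k)) 2 volume :=
  hf.comp_measurePreserving (measurePreserving_add_right volume (k : ℝ))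

theorem memLp_gaborRow {f : ℝ → ℂ} (hf : MemLp f 2 volume) (c a : ℝ) (M n : ℤ) :
    MemLp (fun x : ℝ => gaborRow c a M (fun k => f (x + k)) x n) 2 volume := by
  unfold gaborRow
  refine memLp_finsetSum _ fun k _ => ?_
  refine (hf.comp_add_int k).of_le ?_ (Filter.Eventually.of_forall fun x => ?_)
  · refine (hf.comp_add_int k).1.mul ?_
    exact ((measurable_haarWindow c).comp (by fun_prop :
      Measurable fun x : ℝ => x + k - n * a)).aestronglyMeasurable
  · rw [norm_mul]
    exact mul_le_of_le_one_right (norm_nonneg _) (norm_haarWindow_le _ _)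

/-- The exponential has period 1, so folding the integral over `ℝ` onto `[0, 1]` leaves it untouched
and sums the remaining factor over integer translates. -/
theorem inner_gaborSystem_haarWindow {f : ℝ → ℂ} (hf : MemLp f 2 volume) {c a : ℝ} {M : ℤ}
    (hc : 0 < c) (hM : c + 2 ≤ M) (m n : ℤ) :
    inner ℂ (gaborSystem (haarWindow c) (memLp_haarWindow c) a 1 (m, n)) (hf.toLp f) =
      fourierCoeffOn zero_lt_one
        (fun x : ℝ => gaborRow c a M (fun k => f (x + k)) x n) (-m) := by
  set G : ℝ → ℂ := fun x =>
    f x * (Complex.exp (((2 * Real.pi * m * x : ℝ) : ℂ) * Complex.I) * haarWindow c (x - n * a))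
    with hG
  have hconj : ∀ x : ℝ, inner ℂ (gaborFun (haarWindow c) a 1 m n x) (f x) = G x := by
    intro x
    simp only [hG, gaborFun, RCLike.inner_apply, map_mul, conj_haarWindow, ← Complex.exp_conj,
      Complex.conj_I, Complex.conj_ofReal]
    congr 3
    push_cast
    ring_nf
  have hae : (fun x => inner ℂ
      ((gaborSystem (haarWindow c) (memLp_haarWindow c) a 1 (m, n) : Lp ℂ 2 volume) x)
      ((hf.toLp f : Lp ℂ 2 volume) x)) =ᵐ[volume] G := by
    filter_upwards [hf.coeFn_toLp,
      (memLp_gaborFun (memLp_haarWindow c) a 1 m n).coeFn_toLp] with x h1 h2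
    rw [← hconj, h1, gaborSystem, h2]
  have hint : Integrable G volume := (L2.integrable_inner _ _).congr hae
  rw [L2.inner_def, integral_congr_ae hae, ← hint.hasSum_intervalIntegral_comp_add_int.tsum_eq]
  have hzero : ∀ k : ℤ, ∀ x ∈ Set.Icc (0 : ℝ) 1, k ∉ rowSupport a M n → G (x + k) = 0 := by
    intro k x hx hk
    simp only [hG]
    rw [haarWindow_eq_zero_of_notMem_rowSupport hc hM hx hk, mul_zero, mul_zero]
  rw [tsum_eq_sum (s := rowSupport a M n), ← intervalIntegral.integral_finsetSum,
    fourierCoeffOn_eq_integral]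
  · rw [sub_zero, one_div_one, one_smul]
    refine intervalIntegral.integral_congr fun x _ => ?_
    simp only [gaborRow, smul_eq_mul, Finset.mul_sum, hG]
    refine Finset.sum_congr rfl fun k _ => ?_
    rw [fourier_coe_apply]
    have : Complex.exp (((2 * Real.pi * m * (x + k) : ℝ) : ℂ) * Complex.I) =
        Complex.exp (2 * Real.pi * Complex.I * ((- -m : ℤ) : ℂ) * x / ((1 : ℝ) : ℂ)) := by
      rw [Complex.exp_eq_exp_iff_exists_int]
      refine ⟨m * k, ?_⟩
      push_cast
      rw [div_one]
      ring
    rw [this]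
    ring
  · intro k _
    exact (hint.comp_add_right (k : ℝ)).intervalIntegrable
  · intro k hk
    refine intervalIntegral.integral_zero_ae (Filter.Eventually.of_forall fun x hx => ?_)
    rw [Set.uIoc_of_le zero_le_one] at hx
    exact hzero k x ⟨hx.1.le, hx.2⟩ hk

/-- For fixed `n` the inner products are the Fourier coefficients of one row, up to the sign of `m`;
Parseval is applied row by row. -/
theorem tsum_enorm_inner_gaborSystem {f : ℝ → ℂ} (hf : MemLp f 2 volume) {c a : ℝ} {M : ℤ}
    (hc : 0 < c) (hM : c + 2 ≤ M) :
    ∑' p : ℤ × ℤ, ‖inner ℂ (gaborSystem (haarWindow c) (memLp_haarWindow c) a 1 p)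
        (hf.toLp f)‖ₑ ^ 2 =
      ∫⁻ x in Set.Ioc (0 : ℝ) 1, ∑' n : ℤ,
        ‖gaborRow c a M (fun k => f (x + k)) x n‖ₑ ^ 2 := by
  rw [lintegral_tsum]
  · rw [ENNReal.tsum_prod', ENNReal.tsum_comm]
    refine tsum_congr fun n => ?_
    have hR := (memLp_gaborRow hf c a M n).restrict (Set.Ioc (0 : ℝ) 1)
    have hP := hasSum_sq_fourierCoeffOn zero_lt_one hR
    have hsq : Integrable (fun x => ‖gaborRow c a M (fun k => f (x + k)) x n‖ ^ 2)
      (volume.restrict (Set.Ioc (0 : ℝ) 1)) := hR.integrable_norm_pow (by norm_num)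
    calc ∑' m : ℤ, ‖inner ℂ (gaborSystem (haarWindow c) (memLp_haarWindow c) a 1 (m, n))
          (hf.toLp f)‖ₑ ^ 2
      _ = ∑' m : ℤ, ENNReal.ofReal (‖fourierCoeffOn zero_lt_one
          (fun x : ℝ => gaborRow c a M (fun k => f (x + k)) x n) (-m)‖ ^ 2) := by
          refine tsum_congr fun m => ?_
          rw [inner_gaborSystem_haarWindow hf hc hM, ENNReal.ofReal_pow (norm_nonneg _),
            ofReal_norm]
      _ = ∑' m : ℤ, ENNReal.ofReal (‖fourierCoeffOn zero_lt_one
          (fun x : ℝ => gaborRow c a M (fun k => f (x + k)) x n) m‖ ^ 2) :=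
          (Equiv.neg ℤ).tsum_eq (fun m => ENNReal.ofReal (‖fourierCoeffOn zero_lt_one
          (fun x : ℝ => gaborRow c a M (fun k => f (x + k)) x n) m‖ ^ 2))
      _ = _ := by
          rw [← ENNReal.ofReal_tsum_of_nonneg (fun _ => by positivity) hP.summable, hP.tsum_eq,
            sub_zero, inv_one, one_smul, intervalIntegral.integral_of_le zero_le_one,
            ofReal_integral_eq_lintegral_ofReal hsq
              (Filter.Eventually.of_forall fun _ => by positivity)]
          refine lintegral_congr fun x => ?_
          rw [ENNReal.ofReal_pow (norm_nonneg _), ofReal_norm]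
  · intro n
    exact ((memLp_gaborRow hf c a M n).1.enorm.pow_const 2).restrict

theorem enorm_toLp_sq {f : ℝ → ℂ} (hf : MemLp f 2 volume) :
    ‖hf.toLp f‖ₑ ^ 2 = ∫⁻ x in Set.Ioc (0 : ℝ) 1, ∑' k : ℤ, ‖f (x + k)‖ₑ ^ 2 := by
  rw [lintegral_tsum]
  · rw [← lintegral_eq_tsum_setLIntegral_Ioc_add_int (fun x => ‖f x‖ₑ ^ 2), Lp.enorm_toLp,
      eLpNorm_eq_lintegral_rpow_enorm_toReal (by norm_num) (by norm_num), ← ENNReal.rpow_natCast,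
      ← ENNReal.rpow_mul]
    simp
  · intro k
    exact ((hf.comp_add_int k).1.enorm.pow_const 2).restrict

theorem exists_finset_card_le_of_abs_mul_sub_le {a : ℝ} (ha : 0 < a) (L : ℝ) :
    ∃ N : ℕ, ∀ y : ℝ, ∃ T : Finset ℤ, T.card ≤ N ∧ ∀ n : ℤ, |n * a - y| ≤ L → n ∈ T := by
  refine ⟨(⌊2 * L / a⌋ + 1).toNat, fun y => ⟨Finset.Icc ⌈(y - L) / a⌉ ⌊(y + L) / a⌋, ?_, ?_⟩⟩
  · rw [Int.card_Icc]
    refine Int.toNat_le_toNat ?_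
    have h1 := Int.floor_le ((y + L) / a)
    have h2 := Int.le_ceil ((y - L) / a)
    have h3 : ⌊(y + L) / a⌋ - ⌈(y - L) / a⌉ ≤ ⌊2 * L / a⌋ := by
      rw [Int.le_floor]
      push_cast
      have : 2 * L / a = (y + L) / a - (y - L) / a := by ring
      linarith
    omega
  · intro n hn
    rw [abs_le] at hn
    rw [Finset.mem_Icc, Int.ceil_le, Int.le_floor, div_le_iff₀ ha, le_div_iff₀ ha]
    constructor <;> linarith

/-- Double counting: each `k` belongs to at most `N` of the sets `S n`. -/
theorem ENNReal.tsum_sum_finset_le {S : ℤ → Finset ℤ} {N : ℕ}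
    (hN : ∀ k, ∃ T : Finset ℤ, T.card ≤ N ∧ ∀ n, k ∈ S n → n ∈ T) (u : ℤ → ENNReal) :
    ∑' n, ∑ k ∈ S n, u k ≤ N * ∑' k, u k := by
  have h1 : ∀ n, ∑ k ∈ S n, u k = ∑' k, if k ∈ S n then u k else 0 := by
    intro n
    rw [tsum_eq_sum (s := S n) (fun k hk => if_neg hk)]
    exact Finset.sum_congr rfl fun k hk => (if_pos hk).symm
  simp_rw [h1]
  rw [ENNReal.tsum_comm, ← ENNReal.tsum_mul_left]
  refine ENNReal.tsum_le_tsum fun k => ?_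
  obtain ⟨T, hT, hmem⟩ := hN k
  calc ∑' n, (if k ∈ S n then u k else 0) ≤ ∑' n, (if n ∈ T then u k else 0) := by
        refine ENNReal.tsum_le_tsum fun n => ?_
        by_cases h : k ∈ S n
        · rw [if_pos h, if_pos (hmem n h)]
        · rw [if_neg h]
          exact zero_le
    _ = ∑ n ∈ T, u k := by
        rw [tsum_eq_sum (s := T) (fun k hk => if_neg hk)]
        exact Finset.sum_congr rfl fun k hk => if_pos hk
    _ = T.card * u k := by rw [Finset.sum_const, nsmul_eq_mul]
    _ ≤ N * u k := by gcongr

theorem enorm_sq_eq_ofReal (z : ℂ) : ‖z‖ₑ ^ 2 = ENNReal.ofReal (‖z‖ ^ 2) := by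
  rw [ENNReal.ofReal_pow (norm_nonneg _), ofReal_norm]

theorem enorm_sq_le_mul_sum_enorm_sq {z : ℂ} {w : ℤ → ℂ} {T : Finset ℤ} {C : ℕ}
    (h : ‖z‖ ^ 2 ≤ C * ∑ k ∈ T, ‖w k‖ ^ 2) : ‖z‖ₑ ^ 2 ≤ C * ∑ k ∈ T, ‖w k‖ₑ ^ 2 := by
  simp_rw [enorm_sq_eq_ofReal]
  rw [← ENNReal.ofReal_sum_of_nonneg (fun _ _ => by positivity), ← ENNReal.ofReal_natCast,
    ← ENNReal.ofReal_mul (by positivity)]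
  exact ENNReal.ofReal_le_ofReal h

theorem abs_mul_sub_le_of_mem_rowSupport {a : ℝ} {M n k : ℤ} (hk : k ∈ rowSupport a M n) :
    |n * a - k| ≤ M + 1 := by
  rw [rowSupport, Finset.mem_Icc] at hk
  have h1 := Int.floor_le (n * a)
  have h2 := Int.lt_floor_add_one (n * a)
  have h3 : (⌊n * a⌋ : ℝ) - M ≤ k := by exact_mod_cast hk.1
  have h4 : (k : ℝ) ≤ ⌊n * a⌋ + M := by exact_mod_cast hk.2
  rw [abs_le]
  constructor <;> linarith

theorem card_rowSupport (a : ℝ) (M n : ℤ) : (rowSupport a M n).card = (2 * M + 1).toNat := by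
  rw [rowSupport, Int.card_Icc]
  congr 1
  ring

theorem norm_gaborRow_le (c a : ℝ) (M : ℤ) (v : ℤ → ℂ) (x : ℝ) (n : ℤ) :
    ‖gaborRow c a M v x n‖ ≤ ∑ k ∈ rowSupport a M n, ‖v k‖ := by
  refine (norm_sum_le _ _).trans (Finset.sum_le_sum fun k _ => ?_)
  rw [norm_mul]
  exact mul_le_of_le_one_right (norm_nonneg _) (norm_haarWindow_le _ _)

/-- Cauchy–Schwarz on the `2M + 1` entries of a row, then the overlap count for columns. -/
theorem exists_tsum_enorm_gaborRow_le {a : ℝ} (ha : 0 < a) (c : ℝ) (M : ℤ) :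
    ∃ B : ℕ, ∀ (v : ℤ → ℂ) (x : ℝ),
      ∑' n, ‖gaborRow c a M v x n‖ₑ ^ 2 ≤ B * ∑' k, ‖v k‖ₑ ^ 2 := by
  obtain ⟨N, hN⟩ := exists_finset_card_le_of_abs_mul_sub_le ha (M + 1)
  refine ⟨(2 * M + 1).toNat * N, fun v x => ?_⟩
  calc ∑' n, ‖gaborRow c a M v x n‖ₑ ^ 2
      ≤ ∑' n, ((2 * M + 1).toNat : ENNReal) * ∑ k ∈ rowSupport a M n, ‖v k‖ₑ ^ 2 := by
        refine ENNReal.tsum_le_tsum fun n => enorm_sq_le_mul_sum_enorm_sq ?_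
        rw [← card_rowSupport a M n]
        refine le_trans ?_ sq_sum_le_card_mul_sum_sq
        gcongr
        exact norm_gaborRow_le c a M v x n
    _ = (2 * M + 1).toNat * ∑' n, ∑ k ∈ rowSupport a M n, ‖v k‖ₑ ^ 2 := ENNReal.tsum_mul_left
    _ ≤ (2 * M + 1).toNat * (N * ∑' k, ‖v k‖ₑ ^ 2) := by
        gcongr
        refine ENNReal.tsum_sum_finset_le (fun k => ?_) _
        obtain ⟨T, hT, hmem⟩ := hN k
        exact ⟨T, hT, fun n hn => hmem n (abs_mul_sub_le_of_mem_rowSupport hn)⟩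
    _ = _ := by
        push_cast
        ring

/-- A lower bound uniform in `x` integrates to the lower frame bound. Square-summability of `v` may
be assumed because almost every fiber of an `L²` function has it. -/
theorem isHaarGaborFrame_of_le_tsum_gaborRow {a c : ℝ} (ha : 0 < a) (hc : 0 < c) {M : ℤ}
    (hM : c + 2 ≤ M) {K : ℕ}
    (h : ∀ x ∈ Set.Ioo (0 : ℝ) 1, ∀ v : ℤ → ℂ, ∑' k, ‖v k‖ₑ ^ 2 ≠ ⊤ →
      ∑' k, ‖v k‖ₑ ^ 2 ≤ K * ∑' n, ‖gaborRow c a M v x n‖ₑ ^ 2) :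
    IsHaarGaborFrame c a := by
  obtain ⟨B, hB⟩ := exists_tsum_enorm_gaborRow_le ha c M
  refine ⟨((K : ℝ) + 1)⁻¹, B + 1, by positivity, by positivity, fun g => ?_⟩
  obtain ⟨f, hf, rfl⟩ : ∃ (f : ℝ → ℂ) (hf : MemLp f 2 volume), hf.toLp f = g :=
    ⟨g, Lp.memLp g, Lp.toLp_coeFn g _⟩
  have hsum := tsum_enorm_inner_gaborSystem hf (a := a) hc hM
  have hnorm := enorm_toLp_sq hf
  set S := ∑' p : ℤ × ℤ, ‖inner ℂ (gaborSystem (haarWindow c) (memLp_haarWindow c) a 1 p)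
        (hf.toLp f)‖ₑ ^ 2 with hS
  have hfin : ‖hf.toLp f‖ₑ ^ 2 ≠ ⊤ := by finiteness
  have hupper : S ≤ B * ‖hf.toLp f‖ₑ ^ 2 := by
    rw [hsum, hnorm, ← lintegral_const_mul' _ _ (ENNReal.natCast_ne_top B)]
    exact lintegral_mono fun x => hB _ x
  have hlower : ‖hf.toLp f‖ₑ ^ 2 ≤ K * S := by
    have hmeas : AEMeasurable (fun x : ℝ => ∑' k : ℤ, ‖f (x + k)‖ₑ ^ 2)
        (volume.restrict (Set.Ioc (0 : ℝ) 1)) :=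
      AEMeasurable.tsum fun k => ((hf.comp_add_int k).1.enorm.pow_const 2).restrict
    rw [hnorm] at hfin
    rw [hsum, hnorm, ← lintegral_const_mul' _ _ (ENNReal.natCast_ne_top K)]
    refine lintegral_mono_ae ?_
    have hIoo : ∀ᵐ x ∂(volume.restrict (Set.Ioc (0 : ℝ) 1)), x ∈ Set.Ioo (0 : ℝ) 1 := by
      rw [← restrict_Ioo_eq_restrict_Ioc]
      exact ae_restrict_mem measurableSet_Ioo
    filter_upwards [hIoo, ae_lt_top' hmeas hfin] with x hx hx2
    exact h x hx _ hx2.ne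
  have hSfin : S ≠ ⊤ := ne_top_of_le_ne_top (by finiteness) hupper
  have hsummable : Summable fun p : ℤ × ℤ =>
      ‖inner ℂ (gaborSystem (haarWindow c) (memLp_haarWindow c) a 1 p) (hf.toLp f)‖ ^ 2 := by
    have := ENNReal.summable_toReal hSfin
    simpa using this
  have hSreal : ∑' p : ℤ × ℤ, ‖inner ℂ (gaborSystem (haarWindow c) (memLp_haarWindow c) a 1 p)
      (hf.toLp f)‖ ^ 2 = S.toReal := by
    rw [hS, ENNReal.tsum_toReal_eq (fun _ => by finiteness)]
    simp
  have hnreal : ‖hf.toLp f‖ ^ 2 = (‖hf.toLp f‖ₑ ^ 2).toReal := by simp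
  refine ⟨hsummable, ?_, ?_⟩
  · rw [hSreal, inv_mul_le_iff₀ (by positivity), hnreal]
    have := ENNReal.toReal_mono (by finiteness) hlower
    rw [ENNReal.toReal_mul, ENNReal.toReal_natCast] at this
    have h0 : 0 ≤ S.toReal := ENNReal.toReal_nonneg
    linarith
  · rw [hSreal, hnreal]
    have := ENNReal.toReal_mono (by finiteness) hupper
    rw [ENNReal.toReal_mul, ENNReal.toReal_natCast] at this
    have h0 : 0 ≤ (‖hf.toLp f‖ₑ ^ 2).toReal := ENNReal.toReal_nonneg
    linarith

/-! ### Failure of the lower bound from vanishing row sums -/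

/-- The indicator function of `⋃ (k + (α, β))`, the union being over `|k| ≤ N`. -/
noncomputable def blockIndicator (α β : ℝ) (N : ℕ) : ℝ → ℂ :=
  {x : ℝ | Int.fract x ∈ Set.Ioo α β ∧ ⌊x⌋ ∈ Set.Icc (-N : ℤ) N}.indicator fun _ => 1

theorem memLp_blockIndicator (α β : ℝ) (N : ℕ) : MemLp (blockIndicator α β N) 2 volume := by
  refine memLp_indicator_const 2 ?_ 1 (Or.inr ?_)
  · exact (measurable_fract measurableSet_Ioo).inter (Int.measurable_floor measurableSet_Icc)
  · refine ((measure_mono (t := Set.Icc (-N : ℝ) (N + 1)) ?_).trans_lt measure_Icc_lt_top).ne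
    rintro x ⟨-, h1, h2⟩
    have h3 := Int.floor_le x
    have h4 := Int.lt_floor_add_one x
    have h5 : (-N : ℝ) ≤ ⌊x⌋ := by exact_mod_cast h1
    have h6 : (⌊x⌋ : ℝ) ≤ N := by exact_mod_cast h2
    constructor <;> linarith

theorem blockIndicator_add_int {α β x : ℝ} {N : ℕ} (hx : x ∈ Set.Ioo (0 : ℝ) 1) (k : ℤ) :
    blockIndicator α β N (x + k) =
      if x ∈ Set.Ioo α β ∧ k ∈ Set.Icc (-N : ℤ) N then 1 else 0 := by
  have h1 : Int.fract (x + k) = x := by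
    rw [Int.fract_add_intCast, Int.fract_eq_self]
    exact ⟨hx.1.le, hx.2⟩
  have h2 : ⌊x + k⌋ = k := by
    rw [Int.floor_add_intCast, Int.floor_eq_zero_iff.2 ⟨hx.1.le, hx.2⟩, zero_add]
  simp only [blockIndicator, Set.indicator, Set.mem_ofPred_eq, h1, h2]

theorem enorm_toLp_blockIndicator_sq {α β : ℝ} (hα : 0 ≤ α) (hβ : β ≤ 1) (N : ℕ) :
    ‖(memLp_blockIndicator α β N).toLp‖ₑ ^ 2 = (2 * N + 1 : ℕ) * ENNReal.ofReal (β - α) := by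
  rw [enorm_toLp_sq, ← restrict_Ioo_eq_restrict_Ioc]
  have : ∀ x ∈ Set.Ioo (0 : ℝ) 1, ∑' k : ℤ, ‖blockIndicator α β N (x + k)‖ₑ ^ 2 =
      (Set.Ioo α β).indicator (fun _ => ((2 * N + 1 : ℕ) : ENNReal)) x := by
    intro x hx
    simp_rw [blockIndicator_add_int hx]
    by_cases hx2 : x ∈ Set.Ioo α β
    · rw [Set.indicator_of_mem hx2, tsum_eq_sum (s := Finset.Icc (-N : ℤ) N)]
      · rw [Finset.sum_congr rfl (g := fun _ => 1)]
        · rw [Finset.sum_const, Int.card_Icc, nsmul_one]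
          congr 1
          omega
        · intro k hk
          rw [if_pos ⟨hx2, by simpa using hk⟩]
          simp
      · intro k hk
        rw [if_neg (fun h => hk (by simpa using h.2))]
        simp
    · simp [Set.indicator, hx2]
  rw [setLIntegral_congr_fun measurableSet_Ioo this, setLIntegral_indicator measurableSet_Ioo,
    setLIntegral_const, Set.inter_eq_left.2 (Set.Ioo_subset_Ioo hα hβ), Real.volume_Ioo]

/-- Only rows whose support meets an end `±N` of the truncation can be nonzero, and their number
does not depend on `N`. -/
theorem exists_tsum_enorm_gaborRow_truncation_le {a : ℝ} (ha : 0 < a) (c : ℝ) (M : ℤ) :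
    ∃ D : ℕ, ∀ (N : ℕ) (x : ℝ) (v : ℤ → ℂ),
      (∀ n, ∑ k ∈ rowSupport a M n, haarWindow c (x + k - n * a) = 0) →
      (∀ k, v k = if k ∈ Set.Icc (-N : ℤ) N then 1 else 0) →
      ∑' n, ‖gaborRow c a M v x n‖ₑ ^ 2 ≤ D := by
  obtain ⟨N₀, hN₀⟩ := exists_finset_card_le_of_abs_mul_sub_le ha (M + 1)
  refine ⟨2 * N₀ * (2 * M + 1).toNat ^ 2, fun N x v h hv => ?_⟩
  obtain ⟨T₁, hT₁, hmem₁⟩ := hN₀ (N : ℤ)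
  obtain ⟨T₂, hT₂, hmem₂⟩ := hN₀ (-N : ℤ)
  have hzero : ∀ n ∉ T₁ ∪ T₂, gaborRow c a M v x n = 0 := by
    intro n hn
    rw [Finset.mem_union, not_or] at hn
    have hn1 : (N : ℤ) ∉ rowSupport a M n := fun hmem =>
      hn.1 (hmem₁ n (abs_mul_sub_le_of_mem_rowSupport hmem))
    have hn2 : (-N : ℤ) ∉ rowSupport a M n := fun hmem =>
      hn.2 (hmem₂ n (abs_mul_sub_le_of_mem_rowSupport hmem))
    -- The support is an interval of integers avoiding `N` and `-N`, so it lies inside `[-N, N]` or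
    -- misses it; the row is then a full row sum or identically zero.
    by_cases hsub : ∀ k ∈ rowSupport a M n, k ∈ Set.Icc (-N : ℤ) N
    · rw [gaborRow, ← h n]
      refine Finset.sum_congr rfl fun k hk => ?_
      rw [hv, if_pos (hsub k hk), one_mul]
    · refine Finset.sum_eq_zero fun k hk => ?_
      rw [hv, if_neg, zero_mul]
      intro hk2
      refine hsub fun k' hk' => ?_
      rw [rowSupport, Finset.mem_Icc] at hn1 hn2 hk hk'
      rw [Set.mem_Icc] at hk2 ⊢
      omega
  rw [tsum_eq_sum (s := T₁ ∪ T₂) (fun n hn => by rw [hzero n hn]; simp)]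
  have hbound : ∀ n ∈ T₁ ∪ T₂, ‖gaborRow c a M v x n‖ₑ ^ 2 ≤ ((2 * M + 1).toNat : ENNReal) ^ 2 := by
    intro n _
    gcongr
    rw [← ofReal_norm, ← ENNReal.ofReal_natCast]
    refine ENNReal.ofReal_le_ofReal ((norm_gaborRow_le c a M v x n).trans ?_)
    rw [← card_rowSupport a M n, ← nsmul_one, ← Finset.sum_const]
    refine Finset.sum_le_sum fun k _ => ?_
    rw [hv]
    split_ifs <;> simp
  refine (Finset.sum_le_sum hbound).trans ?_
  rw [Finset.sum_const, nsmul_eq_mul]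
  push_cast
  gcongr
  have := Finset.card_union_le T₁ T₂
  exact_mod_cast (by omega : (T₁ ∪ T₂).card ≤ 2 * N₀)

theorem not_isHaarGaborFrame_of_sum_eq_zero {a c α β : ℝ} (ha : 0 < a) (hc : 0 < c) {M : ℤ}
    (hM : c + 2 ≤ M) (hα : 0 ≤ α) (hαβ : α < β) (hβ : β ≤ 1)
    (h : ∀ x ∈ Set.Ioo α β, ∀ n, ∑ k ∈ rowSupport a M n, haarWindow c (x + k - n * a) = 0) :
    ¬ IsHaarGaborFrame c a := by
  rintro ⟨A, B, hA, -, hAB⟩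
  obtain ⟨D, hD⟩ := exists_tsum_enorm_gaborRow_truncation_le ha c M
  -- The test function has squared norm `(2N+1)(β-α)`, so this `N` pushes the lower frame bound
  -- above the constant `D`.
  obtain ⟨N, hN⟩ := exists_nat_gt (D / (A * (β - α)))
  have hpos : 0 < A * (β - α) := mul_pos hA (sub_pos.2 hαβ)
  rw [div_lt_iff₀ hpos] at hN
  set f := (memLp_blockIndicator α β N).toLp with hf
  obtain ⟨hs, hlow, -⟩ := hAB f
  have hnorm : ‖f‖ ^ 2 = (2 * N + 1) * (β - α) := by
    have : ‖f‖ ^ 2 = (‖f‖ₑ ^ 2).toReal := by simp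
    rw [this, hf, enorm_toLp_blockIndicator_sq hα hβ, ENNReal.toReal_mul, ENNReal.toReal_natCast,
      ENNReal.toReal_ofReal (sub_pos.2 hαβ).le]
    push_cast
    ring
  have hle : ∑' p : ℤ × ℤ, ‖inner ℂ (gaborSystem (haarWindow c) (memLp_haarWindow c) a 1 p) f‖ₑ ^ 2
      ≤ D := by
    rw [hf, tsum_enorm_inner_gaborSystem _ hc hM, ← restrict_Ioo_eq_restrict_Ioc]
    calc _ ≤ ∫⁻ x in Set.Ioo (0 : ℝ) 1, (D : ENNReal) := by
          refine setLIntegral_mono' measurableSet_Ioo fun x hx => ?_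
          by_cases hx2 : x ∈ Set.Ioo α β
          · refine hD N x _ (h x hx2) fun k => ?_
            rw [blockIndicator_add_int hx]
            simp only [hx2, true_and]
          · have hz : ∀ k : ℤ, blockIndicator α β N (x + k) = 0 := fun k => by
              rw [blockIndicator_add_int hx, if_neg fun h => hx2 h.1]
            simp [hz, gaborRow]
      _ = D := by simp
  have hreal : ∑' p : ℤ × ℤ,
      ‖inner ℂ (gaborSystem (haarWindow c) (memLp_haarWindow c) a 1 p) f‖ ^ 2 ≤ D := by
    have h1 := ENNReal.toReal_mono (by finiteness) hle
    rw [ENNReal.tsum_toReal_eq (fun _ => by finiteness), ENNReal.toReal_natCast] at h1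
    simpa using h1
  rw [hnorm] at hlow
  have := mul_nonneg N.cast_nonneg hpos.le
  nlinarith

/-- The conditions on the fractional part say that changing `c` to `N` neither adds nor removes a
point of `s + ℤ`: exactly `N` points lie in each half of the window. -/
theorem sum_haarWindow_eq_zero {c s : ℝ} {N : ℕ} (h1 : |c - N| ≤ Int.fract s)
    (h2 : Int.fract s < 1 - |c - N|) {S : Finset ℤ}
    (hS : ∀ k ∉ S, haarWindow c (s + k) = 0) : ∑ k ∈ S, haarWindow c (s + k) = 0 := by
  have hs : s = ⌊s⌋ + Int.fract s := (Int.floor_add_fract s).symm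
  set y := Int.fract s with hy
  set m := ⌊s⌋ with hm
  have hc1 := le_abs_self (c - N)
  have hc2 := neg_abs_le (c - N)
  have hy0 := Int.fract_nonneg s
  have hpos : ∀ k ∈ Finset.Ico (-m) (-m + N), haarWindow c (s + k) = 1 := by
    intro k hk
    rw [Finset.mem_Ico] at hk
    have e1 : (-m : ℝ) ≤ k := by exact_mod_cast hk.1
    have e2 : (k : ℝ) + 1 ≤ -m + N := by exact_mod_cast hk.2
    exact haarWindow_eq_one (by linarith) (by linarith)
  have hneg : ∀ k ∈ Finset.Ico (-m - N) (-m), haarWindow c (s + k) = -1 := by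
    intro k hk
    rw [Finset.mem_Ico] at hk
    have e1 : (-m - N : ℝ) ≤ k := by exact_mod_cast hk.1
    have e2 : (k : ℝ) + 1 ≤ -m := by exact_mod_cast hk.2
    exact haarWindow_eq_neg_one (by linarith) (by linarith)
  have hzero : ∀ k ∉ Finset.Ico (-m - N) (-m + N), haarWindow c (s + k) = 0 := by
    intro k hk
    rw [Finset.mem_Ico, not_and_or, not_le, not_lt] at hk
    have hN : (0 : ℝ) ≤ N := N.cast_nonneg
    rcases hk with hk | hk
    · have e1 : (k : ℝ) + 1 ≤ -m - N := by exact_mod_cast hk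
      exact haarWindow_eq_zero_of_lt (by linarith) (by linarith)
    · have e1 : (-m + N : ℝ) ≤ k := by exact_mod_cast hk
      exact haarWindow_eq_zero_of_le (by linarith) (by linarith)
  have heq : ∑ k ∈ S, haarWindow c (s + k) =
      ∑ k ∈ Finset.Ico (-m - N) (-m + N), haarWindow c (s + k) := by
    calc _ = ∑' k : ℤ, haarWindow c (s + k) := (tsum_eq_sum hS).symm
      _ = _ := tsum_eq_sum hzero
  rw [heq, ← Finset.Ico_union_Ico_eq_Ico (by omega : -m - (N : ℤ) ≤ -m) (by omega),
    Finset.sum_union (Finset.Ico_disjoint_Ico_consecutive _ _ _), Finset.sum_congr rfl hpos, Finset.sum_congr rfl hneg]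
  simp

theorem not_isHaarGaborFrame_of_fract {a c α β : ℝ} {N : ℕ} (ha : 0 < a) (hc : 0 < c)
    (hα : 0 ≤ α) (hαβ : α < β) (hβ : β ≤ 1)
    (h : ∀ x ∈ Set.Ioo α β, ∀ n : ℤ,
      |c - N| ≤ Int.fract (x - n * a) ∧ Int.fract (x - n * a) < 1 - |c - N|) :
    ¬ IsHaarGaborFrame c a := by
  have hM : c + 2 ≤ (⌈c + 2⌉ : ℤ) := Int.le_ceil _
  refine not_isHaarGaborFrame_of_sum_eq_zero ha hc hM hα hαβ hβ fun x hx n => ?_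
  have hx' : x ∈ Set.Icc (0 : ℝ) 1 := ⟨hα.trans hx.1.le, hx.2.le.trans hβ⟩
  have hcomm : ∀ k : ℤ, x + k - n * a = x - n * a + k := fun k => by ring
  simp_rw [hcomm]
  refine sum_haarWindow_eq_zero (h x hx n).1 (h x hx n).2 fun k hk => ?_
  rw [← hcomm]
  exact haarWindow_eq_zero_of_notMem_rowSupport hc hM hx' hk

theorem not_isHaarGaborFrame_natCast {a : ℝ} (ha : 0 < a) {N : ℕ} (hN : 0 < N) :
    ¬ IsHaarGaborFrame N a := by
  refine not_isHaarGaborFrame_of_fract (N := N) (α := 0) (β := 1) ha (by exact_mod_cast hN)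
    le_rfl zero_lt_one le_rfl fun x _ n => ?_
  rw [sub_self, abs_zero, sub_zero]
  exact ⟨Int.fract_nonneg _, Int.fract_lt_one _⟩

theorem not_isHaarGaborFrame_one_of_abs_sub_lt {c : ℝ} (hc : 0 < c) {N : ℕ}
    (hN : |c - N| < 1 / 2) : ¬ IsHaarGaborFrame c 1 := by
  have h0 := abs_nonneg (c - N)
  refine not_isHaarGaborFrame_of_fract (N := N) (α := |c - N|) (β := 1 - |c - N|) one_pos hc
    h0 (by linarith) (by linarith) fun x hx n => ?_
  have : Int.fract (x - n * 1) = x := by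
    rw [mul_one, Int.fract_sub_intCast, Int.fract_eq_self]
    exact ⟨h0.trans hx.1.le, by linarith [hx.2]⟩
  rw [this]
  exact ⟨hx.1.le, hx.2⟩

theorem exists_fract_sub_mul_div {q : ℕ} (hq : 0 < q) (p : ℕ) {x : ℝ} (hx0 : 0 ≤ x)
    (hx1 : x < 1 / q) (n : ℤ) :
    ∃ i : ℕ, i + 1 ≤ q ∧ Int.fract (x - n * ((p : ℝ) / q)) = x + i / q := by
  have hq' : (0 : ℝ) < q := by exact_mod_cast hq
  have hqz : (0 : ℤ) < q := by exact_mod_cast hq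
  have hnn := Int.emod_nonneg (-n * p) hqz.ne'
  have hlt := Int.emod_lt_of_pos (-n * p) hqz
  refine ⟨((-n * p) % q).toNat, by omega, ?_⟩
  have hcast : ((((-n * p) % q).toNat : ℕ) : ℝ) = (((-n * p) % q : ℤ) : ℝ) := by
    exact_mod_cast congrArg (Int.cast : ℤ → ℝ) (Int.toNat_of_nonneg hnn)
  rw [hcast, Int.fract_eq_iff]
  have hle : (((-n * p) % q : ℤ) : ℝ) + 1 ≤ q := by exact_mod_cast hlt
  have hnn' : (0 : ℝ) ≤ (((-n * p) % q : ℤ) : ℝ) := by exact_mod_cast hnn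
  refine ⟨by positivity, ?_, (-n * p) / q, ?_⟩
  · have h1 : (((-n * p) % q : ℤ) : ℝ) / q ≤ 1 - 1 / q := by
      rw [div_le_iff₀ hq', sub_mul, one_div, inv_mul_cancel₀ hq'.ne']
      linarith
    linarith
  · have hdiv : (((-n * p) % q : ℤ) : ℝ) + q * ((-n * p / q : ℤ) : ℝ) = -n * p := by
      exact_mod_cast Int.emod_add_mul_ediv (-n * p) q
    field_simp
    linarith

/-- The fractional parts of `x - np/q` lie among `x + i/q` with `0 ≤ i < q`. All of them stay in
`[1-c, c)` once `1-c < x < 1/q-(1-c)`, an interval that is nonempty exactly when `c > 1 - 1/(2q)`.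
-/
theorem not_isHaarGaborFrame_div {p q : ℕ} (hp : 0 < p) (hq : 0 < q) {c : ℝ}
    (hc1 : c < 1) (hcq : 1 - 1 / (2 * (q : ℝ)) < c) : ¬ IsHaarGaborFrame c (p / q) := by
  have hp' : (0 : ℝ) < p := by exact_mod_cast hp
  have hq' : (0 : ℝ) < q := by exact_mod_cast hq
  have hq1 : (1 : ℝ) ≤ q := by exact_mod_cast hq
  have habs : |c - (1 : ℕ)| = 1 - c := by
    rw [Nat.cast_one, abs_of_neg (by linarith)]
    ring
  have hhalf : 1 / (2 * (q : ℝ)) = 1 / q / 2 := by field_simp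
  have hinv : 1 / (q : ℝ) ≤ 1 := by rwa [div_le_one hq']
  refine not_isHaarGaborFrame_of_fract (N := 1) (α := 1 - c) (β := 1 / q - (1 - c))
    (by positivity) (by linarith) (by linarith) (by linarith) (by linarith) fun x hx n => ?_
  obtain ⟨i, hi, hfract⟩ := exists_fract_sub_mul_div hq p (x := x) (by linarith [hx.1])
    (by linarith [hx.2]) n
  rw [habs, hfract]
  have hi' : (i : ℝ) / q ≤ 1 - 1 / q := by
    have : (i : ℝ) + 1 ≤ q := by exact_mod_cast hi
    rw [div_le_iff₀ hq', sub_mul, one_div, inv_mul_cancel₀ hq'.ne']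
    linarith
  have hi0 : (0 : ℝ) ≤ i / q := by positivity
  constructor
  · linarith [hx.1]
  · linarith [hx.2]

/-! ### Odd kernels and half-integral windows -/

theorem summable_re_conj_mul {u w : ℤ → ℂ} (hu : Summable fun k => ‖u k‖ ^ 2)
    (hw : Summable fun k => ‖w k‖ ^ 2) :
    Summable fun n => ((starRingEnd ℂ) (u n) * w n).re := by
  refine Summable.of_norm_bounded (hu.add hw) fun n => ?_
  refine (Complex.abs_re_le_norm _).trans ?_
  rw [norm_mul, RCLike.norm_conj]
  nlinarith [sq_nonneg (‖u n‖ - ‖w n‖), sq_nonneg ‖u n‖, sq_nonneg ‖w n‖]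

/-- A convolution whose kernel is the sum of `± δ` and an odd function is bounded below. -/
theorem tsum_enorm_sq_le_of_odd_kernel {b : ℤ → ℝ} (hb0 : |b 0| = 1)
    (hb : ∀ i, i ≠ 0 → b (-i) = -b i) (M : ℤ) (hM : 0 ≤ M) {v r : ℤ → ℂ}
    (hr : ∀ n, r n = ∑ i ∈ Finset.Icc (-M) M, (b i : ℂ) * v (n + i))
    (hv : ∑' k, ‖v k‖ₑ ^ 2 ≠ ⊤) : ∑' k, ‖v k‖ₑ ^ 2 ≤ ∑' n, ‖r n‖ₑ ^ 2 := by
  by_cases hrt : ∑' n, ‖r n‖ₑ ^ 2 = ⊤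
  · rw [hrt]
    exact le_top
  have hvs : Summable fun k => ‖v k‖ ^ 2 := by simpa using ENNReal.summable_toReal hv
  have hrs : Summable fun k => ‖r k‖ ^ 2 := by simpa using ENNReal.summable_toReal hrt
  have hshift : ∀ i : ℤ, Summable fun n => ‖v (n + i)‖ ^ 2 := fun i =>
    (Equiv.addRight i).summable_iff.2 hvs
  -- The real part of the autocorrelation of `v` is even in the lag, so paired with `b` it keeps
  -- only the term at `0`, giving `|Re ⟨v, r⟩| = ‖v‖²`.
  set A : ℤ → ℝ := fun i => ∑' n, ((starRingEnd ℂ) (v n) * v (n + i)).re with hA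
  have hAneg : ∀ i, A (-i) = A i := by
    intro i
    simp only [hA]
    rw [← (Equiv.addRight i).tsum_eq (fun n => ((starRingEnd ℂ) (v n) * v (n + -i)).re)]
    refine tsum_congr fun n => ?_
    simp only [Equiv.coe_addRight, add_neg_cancel_right, Complex.mul_re, Complex.conj_re,
      Complex.conj_im]
    ring
  have hA0 : A 0 = ∑' k, ‖v k‖ ^ 2 := by
    refine tsum_congr fun n => ?_
    rw [add_zero, ← Complex.normSq_eq_conj_mul_self, Complex.ofReal_re, Complex.normSq_eq_norm_sq]
  have hpair : ∑' n, ((starRingEnd ℂ) (v n) * r n).re = ∑ i ∈ Finset.Icc (-M) M, b i * A i := by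
    simp only [hA, ← tsum_mul_left]
    rw [← Summable.tsum_finsetSum
      (fun i _ => (summable_re_conj_mul hvs (hshift i)).mul_left (b i))]
    refine tsum_congr fun n => ?_
    rw [hr, Finset.mul_sum, Complex.re_sum]
    refine Finset.sum_congr rfl fun i _ => ?_
    rw [mul_left_comm, Complex.re_ofReal_mul]
  have hodd : ∑ i ∈ Finset.Icc (-M) M, b i * A i = b 0 * A 0 := by
    have hrefl : ∑ i ∈ Finset.Icc (-M) M, b i * A i =
        ∑ i ∈ Finset.Icc (-M) M, b (-i) * A (-i) := by
      refine Finset.sum_nbij' (fun i => -i) (fun i => -i) ?_ ?_ ?_ ?_ ?_ <;>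
        intro i <;> simp only [Finset.mem_Icc, neg_neg, implies_true]
      · omega
      · omega
    have hadd : ∑ i ∈ Finset.Icc (-M) M, (b i * A i + b (-i) * A (-i)) = 2 * (b 0 * A 0) := by
      rw [Finset.sum_eq_single 0]
      · rw [neg_zero]
        ring
      · intro i _ hi
        rw [hb i hi, hAneg]
        ring
      · intro h0
        exact absurd (Finset.mem_Icc.2 ⟨by omega, hM⟩) h0
    rw [Finset.sum_add_distrib, ← hrefl] at hadd
    linarith
  have hVR : ∑' k, ‖v k‖ ^ 2 ≤ ∑' n, ‖r n‖ ^ 2 := by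
    have h1 : |∑' n, ((starRingEnd ℂ) (v n) * r n).re| = ∑' k, ‖v k‖ ^ 2 := by
      rw [hpair, hodd, abs_mul, hb0, one_mul, hA0, abs_of_nonneg]
      exact tsum_nonneg fun _ => by positivity
    have hs := summable_re_conj_mul hvs hrs
    have h2 : |∑' n, ((starRingEnd ℂ) (v n) * r n).re| ≤
        ∑' n, (‖v n‖ ^ 2 + ‖r n‖ ^ 2) / 2 := by
      have hs2 : Summable fun n => (‖v n‖ ^ 2 + ‖r n‖ ^ 2) / 2 := (hvs.add hrs).div_const 2
      rw [← Real.norm_eq_abs]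
      refine tsum_of_norm_bounded hs2.hasSum fun n => ?_
      rw [Real.norm_eq_abs]
      refine (Complex.abs_re_le_norm _).trans ?_
      rw [norm_mul, RCLike.norm_conj]
      nlinarith [sq_nonneg (‖v n‖ - ‖r n‖)]
    rw [tsum_div_const, hvs.tsum_add hrs] at h2
    linarith
  simp_rw [enorm_sq_eq_ofReal]
  rw [← ENNReal.ofReal_tsum_of_nonneg (fun _ => by positivity) hvs,
    ← ENNReal.ofReal_tsum_of_nonneg (fun _ => by positivity) hrs]
  exact ENNReal.ofReal_le_ofReal hVR

/-- The values of the Haar window on `x + ℤ` in the case of half-integral support. -/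
theorem exists_odd_kernel_haarWindow {N : ℕ} (hN : 1 ≤ N) {x : ℝ} (hx : x ∈ Set.Ioo (0 : ℝ) 1) :
    ∃ (b : ℤ → ℝ) (s : ℤ), |s| ≤ 1 ∧ |b 0| = 1 ∧ (∀ i, i ≠ 0 → b (-i) = -b i) ∧
      ∀ i : ℤ, haarWindow ((2 * (N : ℝ) - 1) / 2) (x + (i + s : ℤ)) = b i := by
  obtain ⟨hx0, hx1⟩ := hx
  have hN' : (1 : ℝ) ≤ N := by exact_mod_cast hN
  have key : ∀ (e : ℝ) (i : ℤ), i ≠ 0 →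
      (fun i : ℤ => if i = 0 then e else
        if 0 < i ∧ i < N then 1 else if i < 0 ∧ -i < N then -1 else 0) (-i) =
      -(fun i : ℤ => if i = 0 then e else
        if 0 < i ∧ i < N then 1 else if i < 0 ∧ -i < N then -1 else 0) i := by
    intro e i hi
    rcases lt_or_gt_of_ne hi with h | h
    · by_cases h2 : -i < N
      · simp [hi, h, h2, not_lt.2 h.le]
      · simp [hi, h, h2, not_lt.2 h.le]
    · by_cases h2 : i < N
      · simp [hi, h, h2, not_lt.2 h.le]
      · simp [hi, h, h2, not_lt.2 h.le]
  have pos_cast : ∀ i : ℤ, 0 < i → (1 : ℝ) ≤ i := fun i h => by exact_mod_cast h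
  have neg_cast : ∀ i : ℤ, i < 0 → (i : ℝ) ≤ -1 := fun i h => by
    have : i ≤ -1 := by omega
    exact_mod_cast this
  have ub : ∀ i : ℤ, i < N → (i : ℝ) ≤ N - 1 := fun i h => by
    have : i ≤ N - 1 := by omega
    exact_mod_cast this
  have ub' : ∀ i : ℤ, ¬ i < N → (N : ℝ) ≤ i := fun i h => by exact_mod_cast not_lt.1 h
  have lb : ∀ i : ℤ, -i < N → (1 - N : ℝ) ≤ i := fun i h => by
    have : 1 - (N : ℤ) ≤ i := by omega
    exact_mod_cast this
  have lb' : ∀ i : ℤ, ¬ -i < N → (i : ℝ) ≤ -N := fun i h => by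
    have : i ≤ -(N : ℤ) := by omega
    exact_mod_cast this
  -- With `c = N - 1/2`, one half of the window contains `N` points of `x + ℤ` and the other `N -
  -- 1`. The unpaired point is `x`, with value `1`, if `x < 1/2`, and `x - 1`, with value `-1`,
  -- otherwise; the shift `s` puts it at index `0`.
  rcases lt_or_ge x (1 / 2) with hx2 | hx2
  · refine ⟨fun i => if i = 0 then 1 else
      if 0 < i ∧ i < N then 1 else if i < 0 ∧ -i < N then -1 else 0, 0, by simp, by simp,
      key _, fun i => ?_⟩
    rw [add_zero]
    rcases lt_trichotomy i 0 with h | h | h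
    · have := neg_cast i h
      by_cases h2 : -i < N
      · have := lb i h2
        rw [haarWindow_eq_neg_one (by linarith) (by linarith)]
        simp [h.ne, h, h2, not_lt.2 h.le]
      · have := lb' i h2
        rw [haarWindow_eq_zero_of_lt (by linarith) (by linarith)]
        simp [h.ne, h, h2, not_lt.2 h.le]
    · subst h
      rw [haarWindow_eq_one (by simpa using hx0.le) (by simp; linarith)]
      simp
    · have := pos_cast i h
      by_cases h2 : i < N
      · have := ub i h2
        rw [haarWindow_eq_one (by linarith) (by linarith)]
        simp [h.ne', h, h2]
      · have := ub' i h2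
        rw [haarWindow_eq_zero_of_le (by linarith) (by linarith)]
        simp [h.ne', h, h2, not_lt.2 h.le]
  · refine ⟨fun i => if i = 0 then -1 else
      if 0 < i ∧ i < N then 1 else if i < 0 ∧ -i < N then -1 else 0, -1, by simp, by simp,
      key _, fun i => ?_⟩
    push_cast
    rcases lt_trichotomy i 0 with h | h | h
    · have := neg_cast i h
      by_cases h2 : -i < N
      · have := lb i h2
        rw [haarWindow_eq_neg_one (by linarith) (by linarith)]
        simp [h.ne, h, h2, not_lt.2 h.le]
      · have := lb' i h2
        rw [haarWindow_eq_zero_of_lt (by linarith) (by linarith)]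
        simp [h.ne, h, h2, not_lt.2 h.le]
    · subst h
      rw [haarWindow_eq_neg_one (by simp; linarith) (by simp; linarith)]
      simp
    · have := pos_cast i h
      by_cases h2 : i < N
      · have := ub i h2
        rw [haarWindow_eq_one (by linarith) (by linarith)]
        simp [h.ne', h, h2]
      · have := ub' i h2
        rw [haarWindow_eq_zero_of_le (by linarith) (by linarith)]
        simp [h.ne', h, h2, not_lt.2 h.le]

theorem isHaarGaborFrame_one {N : ℕ} (hN : 1 ≤ N) :
    IsHaarGaborFrame ((2 * (N : ℝ) - 1) / 2) 1 := by
  have hN' : (1 : ℝ) ≤ N := by exact_mod_cast hN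
  set c := (2 * (N : ℝ) - 1) / 2 with hcdef
  have hc : 0 < c := by rw [hcdef]; linarith
  have hM : c + 2 ≤ (⌈c + 2⌉ : ℤ) := Int.le_ceil _
  set M := ⌈c + 2⌉ with hMdef
  have hM0 : 0 ≤ M := by
    have : (0 : ℝ) ≤ M := by linarith
    exact_mod_cast this
  refine isHaarGaborFrame_of_le_tsum_gaborRow (K := 1) one_pos hc hM fun x hx v hv => ?_
  obtain ⟨b, s, hs, hb0, hb, hH⟩ := exists_odd_kernel_haarWindow hN hx
  have hzero : ∀ i ∉ Finset.Icc (-(M + 1)) (M + 1), b i = 0 := by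
    intro i hi
    have : haarWindow c (x + ((i + s : ℤ) : ℝ) - ((0 : ℤ) : ℝ) * 1) = 0 := by
      refine haarWindow_eq_zero_of_notMem_rowSupport hc hM ⟨hx.1.le, hx.2.le⟩ fun hmem => hi ?_
      rw [abs_le] at hs
      simp only [rowSupport, Int.cast_zero, zero_mul, Int.floor_zero, Finset.mem_Icc] at hmem ⊢
      omega
    rw [Int.cast_zero, zero_mul, sub_zero, hH] at this
    exact_mod_cast this
  rw [Nat.cast_one, one_mul]
  -- Shifting the row index by `-s` centers the kernel; as `|s| ≤ 1`, its support fits in `[-(M+1),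
  -- M+1]`.
  rw [← (Equiv.addRight (-s)).tsum_eq (fun n => ‖gaborRow c 1 M v x n‖ₑ ^ 2)]
  refine tsum_enorm_sq_le_of_odd_kernel hb0 hb (M + 1) (by omega) (fun n => ?_) hv
  rw [Equiv.coe_addRight, gaborRow]
  have h1 : ∀ k ∉ rowSupport 1 M (n + -s),
      v k * haarWindow c (x + k - ((n + -s : ℤ) : ℝ) * 1) = 0 := fun k hk => by
    rw [haarWindow_eq_zero_of_notMem_rowSupport hc hM ⟨hx.1.le, hx.2.le⟩ hk, mul_zero]
  have h2 : ∀ i ∉ Finset.Icc (-(M + 1)) (M + 1), (b i : ℂ) * v (n + i) = 0 := fun i hi => by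
    rw [hzero i hi, Complex.ofReal_zero, zero_mul]
  calc _ = ∑' k : ℤ, v k * haarWindow c (x + k - ((n + -s : ℤ) : ℝ) * 1) := (tsum_eq_sum h1).symm
    _ = ∑' i : ℤ, v (n + i) * haarWindow c (x + (n + i : ℤ) - ((n + -s : ℤ) : ℝ) * 1) :=
        ((Equiv.addLeft n).tsum_eq
          fun k : ℤ => v k * haarWindow c (x + k - ((n + -s : ℤ) : ℝ) * 1)).symm
    _ = ∑' i : ℤ, (b i : ℂ) * v (n + i) := by
        refine tsum_congr fun i => ?_
        rw [mul_comm, ← hH]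
        congr 2
        push_cast
        ring
    _ = _ := tsum_eq_sum h2

/-! ### Short windows: recovering a vector by chains of rows -/

theorem gaborRow_eq_sum {a c x : ℝ} {M n : ℤ} (hc : 0 < c) (hM : c + 2 ≤ M)
    (hx : x ∈ Set.Icc (0 : ℝ) 1) (v : ℤ → ℂ) {T : Finset ℤ}
    (hT : ∀ k ∉ T, haarWindow c (x + k - n * a) = 0) :
    gaborRow c a M v x n = ∑ k ∈ T, v k * haarWindow c (x + k - n * a) := by
  have h1 : ∀ k ∉ rowSupport a M n, v k * haarWindow c (x + k - n * a) = 0 := fun k hk => by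
    rw [haarWindow_eq_zero_of_notMem_rowSupport hc hM hx hk, mul_zero]
  have h2 : ∀ k ∉ T, v k * haarWindow c (x + k - n * a) = 0 := fun k hk => by
    rw [hT k hk, mul_zero]
  calc _ = ∑' k : ℤ, v k * haarWindow c (x + k - n * a) := (tsum_eq_sum h1).symm
    _ = _ := tsum_eq_sum h2

/-- Since `d ≤ c` the window sees `k`, and since `d ≤ 1 - c` it misses every other integer. -/
theorem norm_gaborRow_eq {a c d x : ℝ} {M n k : ℤ} (hc : 0 < c) (hM : c + 2 ≤ M)
    (hx : x ∈ Set.Icc (0 : ℝ) 1) (v : ℤ → ℂ) (hd : d ≤ c) (hd' : d ≤ 1 - c)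
    (h1 : k - d < n * a - x) (h2 : n * a - x ≤ k + d) :
    ‖gaborRow c a M v x n‖ = ‖v k‖ := by
  rw [gaborRow_eq_sum (T := {k}) hc hM hx v, Finset.sum_singleton, norm_mul]
  · rcases lt_or_ge (x + k - n * a) 0 with h | h
    · rw [haarWindow_eq_neg_one (by linarith) h]
      simp
    · rw [haarWindow_eq_one h (by linarith)]
      simp
  · intro k' hk'
    rw [Finset.mem_singleton] at hk'
    rcases lt_or_gt_of_ne hk' with h | h
    · have : (k' : ℝ) + 1 ≤ k := by exact_mod_cast h
      exact haarWindow_eq_zero_of_lt (by linarith) (by linarith)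
    · have : (k : ℝ) + 1 ≤ k' := by exact_mod_cast h
      exact haarWindow_eq_zero_of_le (by linarith) (by linarith)

theorem gaborRow_eq_sub {a c x : ℝ} {M n k : ℤ} (hc : 0 < c) (hc1 : c < 1) (hM : c + 2 ≤ M)
    (hx : x ∈ Set.Icc (0 : ℝ) 1) (v : ℤ → ℂ)
    (h1 : k + 1 - c < n * a - x) (h2 : n * a - x ≤ k + c) :
    gaborRow c a M v x n = v (k + 1) - v k := by
  rw [gaborRow_eq_sum (T := {k, k + 1}) hc hM hx v, Finset.sum_pair (by omega),
    haarWindow_eq_neg_one (by linarith) (by linarith),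
    haarWindow_eq_one (by push_cast; linarith) (by push_cast; linarith)]
  · ring
  · intro k' hk'
    rw [Finset.mem_insert, Finset.mem_singleton, not_or] at hk'
    rcases lt_or_ge k' k with h | h
    · have : (k' : ℝ) + 1 ≤ k := by exact_mod_cast h
      exact haarWindow_eq_zero_of_lt (by linarith) (by linarith)
    · have : (k : ℝ) + 2 ≤ k' := by
        have : k + 2 ≤ k' := by omega
        exact_mod_cast this
      exact haarWindow_eq_zero_of_le (by linarith) (by linarith)

/-- Walk to the right from `k`: each index is either isolated by some row, which ends the walk, or
tied to its successor by a difference row. The walk ends by `k + j`, and every row used costs at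
most `W`. -/
theorem norm_le_of_chain {a c d x W : ℝ} {M : ℤ} (hc : 0 < c) (hc1 : c < 1) (hM : c + 2 ≤ M)
    (hx : x ∈ Set.Icc (0 : ℝ) 1) (v : ℤ → ℂ) (hd : d ≤ c) (hd' : d ≤ 1 - c)
    (h : ∀ k : ℤ, (∃ n : ℤ, k - d < n * a - x ∧ n * a - x ≤ k + d) ∨
      ∃ n : ℤ, k + 1 - c < n * a - x ∧ n * a - x ≤ k + c) (j : ℕ) :
    ∀ k : ℤ, (∀ n : ℤ, k - 1 ≤ n * a - x → n * a - x ≤ k + j + 1 →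
        ‖gaborRow c a M v x n‖ ≤ W) →
      (∃ n : ℤ, k + j - d < n * a - x ∧ n * a - x ≤ k + j + d) → ‖v k‖ ≤ (j + 1) * W := by
  have hd1 : d ≤ 1 := by linarith
  induction j with
  | zero =>
    rintro k hW ⟨n, h1, h2⟩
    simp only [Nat.cast_zero, add_zero, zero_add, one_mul] at *
    rw [← norm_gaborRow_eq hc hM hx v hd hd' h1 h2]
    exact hW n (by linarith) (by linarith)
  | succ j ih =>
    rintro k hW hn
    push_cast at hW hn ⊢
    have hj : (0 : ℝ) ≤ j := j.cast_nonneg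
    rcases h k with ⟨n, h1, h2⟩ | ⟨n, h1, h2⟩
    · have hb := hW n (by linarith) (by linarith)
      have hW0 : 0 ≤ W := (norm_nonneg _).trans hb
      rw [norm_gaborRow_eq hc hM hx v hd hd' h1 h2] at hb
      nlinarith
    · have hb := hW n (by linarith) (by linarith)
      rw [gaborRow_eq_sub hc hc1 hM hx v h1 h2] at hb
      have hnext : ‖v (k + 1)‖ ≤ (j + 1) * W := by
        refine ih (k + 1) (fun n h1 h2 => hW n ?_ ?_) ?_
        · push_cast at h1
          linarith
        · push_cast at h2
          linarith
        · obtain ⟨n, h1, h2⟩ := hn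
          refine ⟨n, ?_, ?_⟩ <;> push_cast <;> linarith
      have htri : ‖v k‖ ≤ ‖v (k + 1)‖ + ‖v (k + 1) - v k‖ := by
        have := norm_sub_le (v (k + 1)) (v (k + 1) - v k)
        rwa [sub_sub_cancel] at this
      linarith

/-- The chain bounds `‖v k‖²` by `(L+1)²` times the sum of `‖row‖²` over rows near `k`; each row is
near at most `N` indices, so summing over `k` costs a factor `N`. -/
theorem isHaarGaborFrame_of_chain {a c d : ℝ} (ha : 0 < a) (hc : 0 < c) (hc1 : c < 1)
    (hd : d ≤ c) (hd' : d ≤ 1 - c)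
    (h : ∀ (x : ℝ) (k : ℤ), (∃ n : ℤ, k - d < n * a - x ∧ n * a - x ≤ k + d) ∨
      ∃ n : ℤ, k + 1 - c < n * a - x ∧ n * a - x ≤ k + c) {L : ℕ}
    (hL : ∀ y : ℝ, ∃ j : ℕ, j ≤ L ∧ ∃ n : ℤ, y + j - d < n * a ∧ n * a ≤ y + j + d) :
    IsHaarGaborFrame c a := by
  have hM : c + 2 ≤ (⌈c + 2⌉ : ℤ) := Int.le_ceil _
  set M := ⌈c + 2⌉
  obtain ⟨N, hN⟩ := exists_finset_card_le_of_abs_mul_sub_le one_pos ((L : ℝ) + 2)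
  refine isHaarGaborFrame_of_le_tsum_gaborRow (K := (L + 1) ^ 2 * N) ha hc hM
    fun x hx v _ => ?_
  have hx' : x ∈ Set.Icc (0 : ℝ) 1 := ⟨hx.1.le, hx.2.le⟩
  set S : ℤ → Finset ℤ := fun k => Finset.Icc ⌈(k - (L + 2)) / a⌉ ⌊(k + (L + 2)) / a⌋ with hS
  have hmem : ∀ k n : ℤ, n ∈ S k ↔ k - (L + 2) ≤ n * a ∧ n * a ≤ k + (L + 2) := by
    intro k n
    simp only [hS]
    rw [Finset.mem_Icc, Int.ceil_le, Int.le_floor, div_le_iff₀ ha, le_div_iff₀ ha]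
  have hbound : ∀ k, ‖v k‖ₑ ^ 2 ≤ ((L + 1) ^ 2 : ℕ) *
      ∑ n ∈ S k, ‖gaborRow c a M v x n‖ₑ ^ 2 := by
    intro k
    refine enorm_sq_le_mul_sum_enorm_sq ?_
    set Q := ∑ n ∈ S k, ‖gaborRow c a M v x n‖ ^ 2 with hQ
    have hQ0 : 0 ≤ Q := Finset.sum_nonneg fun _ _ => by positivity
    obtain ⟨j, hj, n, h1, h2⟩ := hL (x + k)
    have hj' : (j : ℝ) ≤ L := by exact_mod_cast hj
    have hv : ‖v k‖ ≤ (j + 1) * √Q := by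
      refine norm_le_of_chain hc hc1 hM hx' v hd hd' (h x) j k (fun n h1 h2 => ?_)
        ⟨n, by linarith, by linarith⟩
      refine Real.le_sqrt_of_sq_le ?_
      refine Finset.single_le_sum (f := fun n => ‖gaborRow c a M v x n‖ ^ 2)
        (fun _ _ => by positivity) ((hmem k n).2 ⟨?_, ?_⟩)
      · linarith [hx.1, (j.cast_nonneg : (0 : ℝ) ≤ j)]
      · linarith [hx.2]
    calc ‖v k‖ ^ 2 ≤ ((L + 1) * √Q) ^ 2 := by
          gcongr
          exact hv.trans (by gcongr)
      _ = _ := by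
          rw [mul_pow, Real.sq_sqrt hQ0]
          push_cast
          ring
  calc ∑' k, ‖v k‖ₑ ^ 2
      ≤ ∑' k, (((L + 1) ^ 2 : ℕ) : ENNReal) * ∑ n ∈ S k, ‖gaborRow c a M v x n‖ₑ ^ 2 :=
        ENNReal.tsum_le_tsum hbound
    _ = ((L + 1) ^ 2 : ℕ) * ∑' k, ∑ n ∈ S k, ‖gaborRow c a M v x n‖ₑ ^ 2 :=
        ENNReal.tsum_mul_left
    _ ≤ ((L + 1) ^ 2 : ℕ) * (N * ∑' n, ‖gaborRow c a M v x n‖ₑ ^ 2) := by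
        gcongr
        refine ENNReal.tsum_sum_finset_le (fun n => ?_) _
        obtain ⟨T, hT, hT2⟩ := hN (n * a)
        refine ⟨T, hT, fun k hk => hT2 k ?_⟩
        rw [hmem] at hk
        rw [abs_le]
        constructor <;> linarith
    _ = _ := by
        push_cast
        ring

/-- With `d = c` every index is isolated, because a half-open interval of length `2c ≥ a` contains a
multiple of `a`. -/
theorem isHaarGaborFrame_of_le_half {a c : ℝ} (ha : 0 < a) (hac : a / 2 ≤ c) (hc : c ≤ 1 / 2) :
    IsHaarGaborFrame c a := by
  have hstep : ∀ y : ℝ, ∃ n : ℤ, y - c < n * a ∧ n * a ≤ y + c := by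
    intro y
    have h1 := Int.floor_le ((y + c) / a)
    have h2 := Int.lt_floor_add_one ((y + c) / a)
    rw [le_div_iff₀ ha] at h1
    rw [div_lt_iff₀ ha] at h2
    exact ⟨⌊(y + c) / a⌋, by linarith, h1⟩
  refine isHaarGaborFrame_of_chain (d := c) (L := 0) ha (by linarith) (by linarith) le_rfl
    (by linarith) (fun x k => Or.inl ?_) fun y => ⟨0, le_rfl, ?_⟩
  · obtain ⟨n, h1, h2⟩ := hstep (x + k)
    exact ⟨n, by linarith, by linarith⟩
  · simpa using hstep y

theorem isHaarGaborFrame_of_half_lt {a c : ℝ} (ha : 0 < a) (ha1 : a ≤ 1) (hc : 1 / 2 < c)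
    (hc1 : c < 1) {L : ℕ}
    (hL : ∀ y : ℝ, ∃ j : ℕ, j ≤ L ∧ ∃ n : ℤ, y + j - (1 - c) < n * a ∧ n * a ≤ y + j + (1 - c)) :
    IsHaarGaborFrame c a := by
  refine isHaarGaborFrame_of_chain (d := 1 - c) ha (by linarith) hc1 (by linarith) le_rfl
    (fun x k => ?_) hL
  -- The largest multiple of `a` not exceeding `x + k + c` exceeds `x + k + c - 1`, as `a ≤ 1`. It
  -- isolates `k` if it is at most `x + k + (1 - c)` and otherwise gives a difference row.
  have h1 := Int.floor_le ((x + k + c) / a)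
  have h2 := Int.lt_floor_add_one ((x + k + c) / a)
  rw [le_div_iff₀ ha] at h1
  rw [div_lt_iff₀ ha] at h2
  rcases le_or_gt (⌊(x + k + c) / a⌋ * a - x) (k + (1 - c)) with h | h
  · exact Or.inl ⟨⌊(x + k + c) / a⌋, by linarith, h⟩
  · exact Or.inr ⟨⌊(x + k + c) / a⌋, by linarith, by linarith⟩

/-! ### Bounded approximation by multiples of `a` modulo integers -/

theorem Irrational.exists_bounded_approx {a d : ℝ} (ha : 0 < a) (hirr : Irrational a)
    (hd : 0 < d) :
    ∃ L : ℕ, ∀ y : ℝ, ∃ j : ℕ, j ≤ L ∧ ∃ n : ℤ, y + j - d < n * a ∧ n * a ≤ y + j + d := by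
  have hdense : Dense (AddSubgroup.closure {a, 1} : Set ℝ) :=
    dense_addSubgroupClosure_pair_iff.2 (by rwa [div_one])
  -- Take `δ = n₀ a + m₀` in `(0, d)`. At most `⌈a/δ⌉` steps of size `δ` bring any residue `w` in
  -- `[0, a)` to within `δ`; the offset `J` dominates `|i m₀|`, so `j = J - i m₀` lies in `[0, 2J]`.
  obtain ⟨δ, hδ, hδ0, hδd⟩ := hdense.exists_between hd
  obtain ⟨n₀, m₀, hnm⟩ := AddSubgroup.mem_closure_pair.1 hδ
  simp only [zsmul_eq_mul, mul_one] at hnm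
  set I := ⌈a / δ⌉₊ with hI
  set J : ℤ := I * |m₀| with hJ
  refine ⟨(2 * J).toNat, fun y => ?_⟩
  set w := y + J - ⌊(y + J) / a⌋ * a with hw
  have hw0 : 0 ≤ w := by
    have := Int.floor_le ((y + J) / a)
    rw [le_div_iff₀ ha] at this
    linarith
  have hwa : w < a := by
    have := Int.lt_floor_add_one ((y + J) / a)
    rw [div_lt_iff₀ ha] at this
    linarith
  set i := ⌊w / δ⌋₊ with hi
  have hi1 : i * δ ≤ w := by
    rw [← le_div_iff₀ hδ0]
    exact Nat.floor_le (by positivity)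
  have hi2 : w < (i + 1) * δ := by
    rw [← div_lt_iff₀ hδ0]
    exact Nat.lt_floor_add_one _
  have hiI : i ≤ I := by
    refine Nat.floor_le_of_le (le_trans ?_ (Nat.le_ceil _))
    gcongr
  have hJi : |i * m₀| ≤ J := by
    rw [abs_mul, Nat.abs_cast, hJ]
    have : (i : ℤ) ≤ I := by exact_mod_cast hiI
    gcongr
  rw [abs_le] at hJi
  refine ⟨(J - i * m₀).toNat, by omega, ⌊(y + J) / a⌋ + i * n₀, ?_⟩
  have hcast : (((J - i * m₀).toNat : ℕ) : ℝ) = J - i * m₀ := by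
    have : (((J - i * m₀).toNat : ℕ) : ℤ) = J - i * m₀ := Int.toNat_of_nonneg (by omega)
    exact_mod_cast congrArg (Int.cast : ℤ → ℝ) this
  have hna : ((⌊(y + J) / a⌋ + i * n₀ : ℤ) : ℝ) * a = y + J - w + i * (δ - m₀) := by
    push_cast
    rw [hw, ← hnm]
    ring
  rw [hcast, hna]
  constructor <;> linarith

/-- A half-open interval of length `2d ≥ 1/q` contains some `l/q`. Bézout writes `l = np - jq`, and
`j` may be reduced modulo `p`, so that `n(p/q) = l/q + j`. -/
theorem exists_bounded_approx_div {p q : ℕ} (hp : 0 < p) (hq : 0 < q) (hpq : Nat.Coprime p q)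
    {d : ℝ} (hd : 1 / (2 * (q : ℝ)) ≤ d) (y : ℝ) :
    ∃ j : ℕ, j ≤ p ∧ ∃ n : ℤ, y + j - d < n * ((p : ℝ) / q) ∧ n * ((p : ℝ) / q) ≤ y + j + d := by
  have hq' : (0 : ℝ) < q := by exact_mod_cast hq
  have hpz : (0 : ℤ) < p := by exact_mod_cast hp
  obtain ⟨u, w, huw⟩ := Nat.isCoprime_iff_coprime.2 hpq
  set l := ⌊q * (y + d)⌋ with hl
  have hl1 : (l : ℝ) ≤ q * (y + d) := Int.floor_le _
  have hl2 : q * (y + d) < l + 1 := Int.lt_floor_add_one _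
  have hnn := Int.emod_nonneg (-l * w) hpz.ne'
  have hlt := Int.emod_lt_of_pos (-l * w) hpz
  refine ⟨((-l * w) % p).toNat, by omega, l * u - (-l * w) / p * q, ?_⟩
  have hcast : ((((-l * w) % p).toNat : ℕ) : ℝ) = (((-l * w) % p : ℤ) : ℝ) := by
    exact_mod_cast congrArg (Int.cast : ℤ → ℝ) (Int.toNat_of_nonneg hnn)
  have hsplit : (l * u - (-l * w) / p * q) * p = l + (-l * w) % p * q := by
    have h1 := Int.emod_add_mul_ediv (-l * w) p
    linear_combination l * huw - (q : ℤ) * h1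
  have hsplit' : ((l * u - (-l * w) / p * q : ℤ) : ℝ) * p = l + (((-l * w) % p : ℤ) : ℝ) * q := by
    exact_mod_cast congrArg (Int.cast : ℤ → ℝ) hsplit
  have hval : ((l * u - (-l * w) / p * q : ℤ) : ℝ) * ((p : ℝ) / q) =
      l / q + (((-l * w) % p : ℤ) : ℝ) := by
    rw [← mul_div_assoc, hsplit', add_div, mul_div_cancel_right₀ _ hq'.ne']
  rw [hcast, hval]
  have h1 : (l : ℝ) / q ≤ y + d := by
    rw [div_le_iff₀ hq']
    linarith
  have h2 : y + d - 1 / q < (l : ℝ) / q := by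
    rw [lt_div_iff₀ hq', sub_mul, one_div, inv_mul_cancel₀ hq'.ne']
    linarith
  have h3 : 1 / (2 * (q : ℝ)) = 1 / q / 2 := by field_simp
  constructor <;> linarith

/-! ### Assembly of the four statements -/

theorem theorem2p1 (a c : ℝ) (ha : 0 < a) (hc : 0 < c) :
    ((∃ n : ℕ, c = n) → ¬ IsHaarGaborFrame c a) ∧
    (a = 1 → 1 / 2 ≤ c →
      (IsHaarGaborFrame c a ↔ ∃ n : ℕ, 1 ≤ n ∧ c = (2 * (n : ℝ) - 1) / 2)) ∧
    (a < 1 → Irrational a → a / 2 ≤ c → c < 1 → IsHaarGaborFrame c a) ∧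
    (∀ p q : ℕ, 0 < p → 0 < q → Nat.Coprime p q → a = (p : ℝ) / (q : ℝ) →
      a < 1 → a / 2 ≤ c → c < 1 →
        (IsHaarGaborFrame c a ↔ c ≤ 1 - 1 / (2 * (q : ℝ)))) := by
  refine ⟨?_, ?_, ?_, ?_⟩
  · rintro ⟨n, rfl⟩
    exact not_isHaarGaborFrame_natCast ha (by exact_mod_cast hc)
  · rintro rfl -
    constructor
    · intro hframe
      refine ⟨⌊c⌋₊ + 1, by omega, ?_⟩
      have h1 := Nat.floor_le hc.le
      have h2 := Nat.lt_floor_add_one c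
      -- If `c` is not `⌊c⌋ + 1/2`, then `⌊c⌋` or `⌊c⌋ + 1` lies at distance less than `1/2` from
      -- it.
      by_contra hne
      push_cast at hne
      rcases lt_or_gt_of_ne hne with h | h
      · refine not_isHaarGaborFrame_one_of_abs_sub_lt hc (N := ⌊c⌋₊) ?_ hframe
        rw [abs_lt]
        constructor <;> linarith
      · refine not_isHaarGaborFrame_one_of_abs_sub_lt hc (N := ⌊c⌋₊ + 1) ?_ hframe
        push_cast
        rw [abs_lt]
        constructor <;> linarith
    · rintro ⟨n, hn, rfl⟩
      exact isHaarGaborFrame_one hn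
  · intro ha1 hirr hac hc1
    rcases le_or_gt c (1 / 2) with h | h
    · exact isHaarGaborFrame_of_le_half ha hac h
    · obtain ⟨L, hL⟩ := hirr.exists_bounded_approx ha (sub_pos.2 hc1)
      exact isHaarGaborFrame_of_half_lt ha ha1.le h hc1 hL
  · rintro p q hp hq hpq rfl ha1 hac hc1
    constructor
    · intro hframe
      by_contra! hcq
      exact not_isHaarGaborFrame_div hp hq hc1 hcq hframe
    · intro hcq
      rcases le_or_gt c (1 / 2) with h | h
      · exact isHaarGaborFrame_of_le_half ha hac h
      · exact isHaarGaborFrame_of_half_lt ha ha1.le h hc1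
          (exists_bounded_approx_div hp hq hpq (by linarith))
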